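/- Let $p_1,p_2,r\ge 1$ be integers and let $f:\mathbb{R}^{p_1\times p_2}\to\mathbb{R}$ be twice continuously differentiable. Write $\nabla f$ and $\nabla^2 f$ for its Euclidean gradient and Hessian (with respect to the trace inner product), $\|\cdot\|_F$ for the Frobenius norm, $\sigma_k(\cdot)$ for the $k$-th largest singular value, $\lambda_{\min}$ for the least eigenvalue, and $a\wedge b=\min\{a,b\}$. Suppose that $f$ satisfies the $(2r,4r)$-restricted strong convexity and smoothness property with constants $\alpha_2\ge\alpha_1>0$, that is, $$\alpha_1\|G\|_F^2\le\nabla^2 f(X)[G,G]\le\alpha_2\|G\|_F^2$$ for all $X,G\in\mathbb{R}^{p_1\times p_2}$ with $\operatorname{rank}(X)\le 2r$ and $\operatorname{rank}(G)\le 4r$, and that $\alpha_2/\alpha_1\le 1.5$. Suppose further that $X^*\in\mathbb{R}^{p_1\times p_2}$ has rank $r$ and $\nabla f(X^*)=0$. Let $g(L,R)=f(LR^\top)$ for $L\in\mathbb{R}^{p_1\times r}$, $R\in\mathbb{R}^{p_2\times r}$, regarded as a function of the stacked matrix $[L^\top\ R^\top]^\top\in\mathbb{R}^{(p_1+p_2)\times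 r}$. Let $(L,R)$ be a Euclidean first-order stationary point of $g$ (that is, $\nabla g(L,R)=0$) such that $LR^\top$ has rank $r$. Then one of the following holds: 1. $(L,R)$ is a Euclidean second-order stationary point of $g$ (that is, $\nabla g(L,R)=0$ and $\nabla^2 g(L,R)\succeq 0$) and $LR^\top=X^*$; or 2. $(L,R)$ is a strict saddle of $g$ (that is, $\nabla g(L,R)=0$ and $\nabla^2 g(L,R)$ has a negative eigenvalue), and $$\lambda_{\min}\bigl(\nabla^2 g(L,R)\bigr)\le -0.08\left(\frac{\sigma_r^2(L)}{\sigma_1(LR^\top)}\wedge\frac{\sigma_r(LR^\top)}{\sigma_1^2(L)}\right)\alpha_1\,\sigma_r(X^*).$$ -/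

import Mathlib

open Matrix

/- Matrix spaces carry the Frobenius norm. -/
attribute [local instance] Matrix.frobeniusNormedAddCommGroup Matrix.frobeniusNormedSpace

namespace LowRankFactorization

noncomputable section

/-- The Frobenius (trace) inner product `⟨A, B⟩ = ∑ i j, A i j * B i j`. -/
def frobInner {m n : Type*} [Fintype m] [Fintype n] (A B : Matrix m n ℝ) : ℝ :=
  ∑ i, ∑ j, A i j * B i j

/-- The Euclidean gradient of `h` at `X`: the matrix of partial derivatives `∂h(X)/∂X i j`. -/
def euclGrad {m n : Type*} [Fintype m] [Fintype n] [DecidableEq m] [DecidableEq n]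
    (h : Matrix m n ℝ → ℝ) (X : Matrix m n ℝ) : Matrix m n ℝ :=
  Matrix.of fun i j => fderiv ℝ h X (Matrix.single i j 1)

/-- The Euclidean Hessian of `h` at `X`, as the linear operator `Z ↦ D(∇h)(X)[Z]`. -/
def euclHess {m n : Type*} [Fintype m] [Fintype n] [DecidableEq m] [DecidableEq n]
    (h : Matrix m n ℝ → ℝ) (X : Matrix m n ℝ) : Module.End ℝ (Matrix m n ℝ) :=
  (fderiv ℝ (euclGrad h) X : Matrix m n ℝ →ₗ[ℝ] Matrix m n ℝ)

/-- The bilinear form of the Euclidean Hessian: `∇²h(X)[Z₁, Z₂] = ⟨∇²h(X)[Z₁], Z₂⟩`. -/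
def hessForm {m n : Type*} [Fintype m] [Fintype n] [DecidableEq m] [DecidableEq n]
    (h : Matrix m n ℝ → ℝ) (X Z₁ Z₂ : Matrix m n ℝ) : ℝ :=
  frobInner (euclHess h X Z₁) Z₂

/-- The least eigenvalue of an operator on a (nonzero, finite-dimensional) matrix space.
It is only used for Hessians of `C²` functions, which are symmetric, so that the set of real
eigenvalues is finite and nonempty and the infimum is a minimum. -/
def lambdaMin {m n : Type*} (T : Module.End ℝ (Matrix m n ℝ)) : ℝ :=
  sInf {t : ℝ | T.HasEigenvalue t}

/-- Euclidean first-order stationary point. -/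
def IsFOSP {m n : Type*} [Fintype m] [Fintype n] [DecidableEq m] [DecidableEq n]
    (h : Matrix m n ℝ → ℝ) (X : Matrix m n ℝ) : Prop :=
  euclGrad h X = 0

/-- Euclidean second-order stationary point. -/
def IsSOSP {m n : Type*} [Fintype m] [Fintype n] [DecidableEq m] [DecidableEq n]
    (h : Matrix m n ℝ → ℝ) (X : Matrix m n ℝ) : Prop :=
  euclGrad h X = 0 ∧ ∀ Z, 0 ≤ hessForm h X Z Z

/-- Strict saddle: a first-order stationary point whose Hessian has a negative eigenvalue. -/
def IsStrictSaddle {m n : Type*} [Fintype m] [Fintype n] [DecidableEq m] [DecidableEq n]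
    (h : Matrix m n ℝ → ℝ) (X : Matrix m n ℝ) : Prop :=
  IsFOSP h X ∧ ∃ t : ℝ, t < 0 ∧ (euclHess h X).HasEigenvalue t

/-- `(2r, 4r)`-restricted strong convexity and smoothness with constants `α₁, α₂`. -/
def RSCRSM {m n : Type*} [Fintype m] [Fintype n] [DecidableEq m] [DecidableEq n]
    (r : ℕ) (α₁ α₂ : ℝ) (f : Matrix m n ℝ → ℝ) : Prop :=
  0 < α₁ ∧ α₁ ≤ α₂ ∧ ∀ X G : Matrix m n ℝ, X.rank ≤ 2 * r → G.rank ≤ 4 * r →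
    α₁ * ‖G‖ ^ 2 ≤ hessForm f X G G ∧ hessForm f X G G ≤ α₂ * ‖G‖ ^ 2

/-- The unregularized factorization objective `g(L, R) = f(L Rᵀ)`, as a function of the stacked
matrix with upper block `L` and lower block `R`. -/
def factorObj {p₁ p₂ r : ℕ} (f : Matrix (Fin p₁) (Fin p₂) ℝ → ℝ)
    (W : Matrix (Fin p₁ ⊕ Fin p₂) (Fin r) ℝ) : ℝ :=
  f (W.toRows₁ * W.toRows₂ᵀ)

/-- The `k`-th largest singular value `σ_k(A)`, for `k ≥ 1` (Mathlib counts from `0`). -/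
def sigma {m n : Type*} [Fintype m] [Fintype n] [DecidableEq m] [DecidableEq n]
    (k : ℕ) (A : Matrix m n ℝ) : ℝ :=
  (Matrix.toEuclideanLin A).singularValues (k - 1)

end

end LowRankFactorization

/-! Write `X = L * Rᵀ`, `F` for the gradient of `f` at `X`, `M` for the minimizer and `s = σ_r(X)`,
`κ = σ_r(M)`. The claim is proved by contraposition: if the Hessian of the factorized objective is
nowhere more negative than the stated bound, then `X = M`.

Stationarity makes `F` vanish on the singular vectors of `X` from both sides. In an SVD `M = ∑ κ_j
a_j b_jᵀ`, only the residuals `x_j`, `y_j` of `a_j`, `b_j` off those singular subspaces therefore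
contribute to `⟨F, M⟩`. Let `γ_j` be the average of their squared norms. Testing the Hessian on
rank-one directions built from `x_j`, `y_j` and the last singular pair of `X`
(`hessForm_rank_one_direction_le`) gives `-⟨F, M⟩ ≤ (α₂ s + 0.08 α₁ κ) ∑ γ_j κ_j`.

Conversely, `⟨F, X⟩ = 0` and restricted convexity on the line through `M` and `X` give `α₁ ‖X - M‖²
≤ -⟨F, M⟩`, while `sum_residual_le_norm_sub_sq` gives `∑ γ_j (s² + κ_j²) ≤ ‖X - M‖²`. As `s² + κ_j²
≥ (3/2 s + 7/16 κ) κ_j` and `α₂ ≤ 3/2 α₁`, the two bounds force `∑ γ_j κ_j = 0`, hence `X = M`. Any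
constant below `7/16` could replace `0.08`. -/

namespace LowRankFactorization

/-! ### The Frobenius inner product -/

section FrobeniusInner

variable {m n : Type*} [Fintype m] [Fintype n]

theorem norm_sq_eq_frobInner (A : Matrix m n ℝ) : ‖A‖ ^ 2 = frobInner A A := by
  rw [Matrix.frobenius_norm_def, ← Real.sqrt_eq_rpow, Real.sq_sqrt (by positivity)]
  simp [frobInner, pow_two]

theorem frobInner_add_left (A B C : Matrix m n ℝ) :
    frobInner (A + B) C = frobInner A C + frobInner B C := by
  simp [frobInner, add_mul, Finset.sum_add_distrib]

theorem frobInner_smul_left (c : ℝ) (A B : Matrix m n ℝ) :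
    frobInner (c • A) B = c * frobInner A B := by
  simp [frobInner, Finset.mul_sum, mul_assoc]

theorem frobInner_comm (A B : Matrix m n ℝ) : frobInner A B = frobInner B A := by
  simp [frobInner, mul_comm]

theorem frobInner_add_right (A B C : Matrix m n ℝ) :
    frobInner A (B + C) = frobInner A B + frobInner A C := by
  simp only [frobInner_comm A, frobInner_add_left]

theorem frobInner_smul_right (c : ℝ) (A B : Matrix m n ℝ) :
    frobInner A (c • B) = c * frobInner A B := by
  simp only [frobInner_comm A, frobInner_smul_left]

theorem frobInner_sub_right (A B C : Matrix m n ℝ) :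
    frobInner A (B - C) = frobInner A B - frobInner A C := by
  simp [frobInner, mul_sub, Finset.sum_sub_distrib]

theorem frobInner_sum_right {ι : Type*} (s : Finset ι) (A : Matrix m n ℝ)
    (B : ι → Matrix m n ℝ) : frobInner A (∑ i ∈ s, B i) = ∑ i ∈ s, frobInner A (B i) := by
  classical
  induction s using Finset.induction_on with
  | empty => simp [frobInner]
  | insert i s hi ih => simp [Finset.sum_insert hi, frobInner_add_right, ih]

theorem frobInner_sum_left {ι : Type*} (s : Finset ι) (A : Matrix m n ℝ)
    (B : ι → Matrix m n ℝ) : frobInner (∑ i ∈ s, B i) A = ∑ i ∈ s, frobInner (B i) A := by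
  simp only [frobInner_comm _ A, frobInner_sum_right]

theorem frobInner_vecMulVec_right (A : Matrix m n ℝ) (x : m → ℝ) (y : n → ℝ) :
    frobInner A (vecMulVec x y) = x ⬝ᵥ A *ᵥ y := by
  simp only [frobInner, vecMulVec_apply, dotProduct, mulVec, Finset.mul_sum]
  exact Finset.sum_congr rfl fun i _ => Finset.sum_congr rfl fun j _ => by ring

theorem frobInner_vecMulVec (x z : m → ℝ) (y w : n → ℝ) :
    frobInner (vecMulVec x y) (vecMulVec z w) = (x ⬝ᵥ z) * (y ⬝ᵥ w) := by
  simp only [frobInner, vecMulVec_apply, dotProduct, Finset.sum_mul_sum]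
  exact Finset.sum_congr rfl fun i _ => Finset.sum_congr rfl fun j _ => by ring

end FrobeniusInner

/-! ### Second derivatives, quadratic substitution and convexity along a line -/

section SecondDerivative

variable {E F : Type*} [NormedAddCommGroup E] [NormedSpace ℝ E] [FiniteDimensional ℝ E]
  [NormedAddCommGroup F] [NormedSpace ℝ F]

theorem differentiable_fderiv_of_contDiff_two {h : F → ℝ} (hh : ContDiff ℝ 2 h) :
    Differentiable ℝ (fderiv ℝ h) :=
  (hh.fderiv_right (m := 1) (by norm_num)).differentiable (by norm_num)

/-- `euclGrad` has this form, with `J` arranging the partial derivatives into a matrix. A linear `J`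
commutes with differentiation. -/
theorem fderiv_linear_comp_fderiv {ι : Type*} [Fintype ι] [FiniteDimensional ℝ F] {h : F → ℝ}
    (hh : ContDiff ℝ 2 h) (e : ι → F) (J : (ι → ℝ) →ₗ[ℝ] F) (X Z : F) :
    fderiv ℝ (fun Y => J fun i => fderiv ℝ h Y (e i)) X Z =
      J fun i => fderiv ℝ (fderiv ℝ h) X Z (e i) := by
  let ℓ : (F →L[ℝ] ℝ) →ₗ[ℝ] F := J ∘ₗ
    { toFun := fun φ i => φ (e i)
      map_add' := fun φ ψ => by ext; simp
      map_smul' := fun c φ => by ext; simp }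
  have hg : HasFDerivAt (fun Y => J fun i => fderiv ℝ h Y (e i))
      ((LinearMap.toContinuousLinearMap ℓ).comp (fderiv ℝ (fderiv ℝ h) X)) X :=
    (LinearMap.toContinuousLinearMap ℓ).hasFDerivAt.comp X
      (differentiable_fderiv_of_contDiff_two hh X).hasFDerivAt
  rw [hg.fderiv]
  rfl

theorem fderiv_fderiv_comm {h : F → ℝ} (hh : ContDiff ℝ 2 h) (X Z Z' : F) :
    fderiv ℝ (fderiv ℝ h) X Z Z' = fderiv ℝ (fderiv ℝ h) X Z' Z :=
  (hh.contDiffAt.isSymmSndFDerivAt (by simp)).eq Z Z'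

theorem exists_continuousBilinear (B : E →ₗ[ℝ] E →ₗ[ℝ] F) :
    ∃ C : E →L[ℝ] E →L[ℝ] F, ∀ x y, C x y = B x y :=
  ⟨LinearMap.toContinuousLinearMap ((LinearMap.toContinuousLinearMap (𝕜 := ℝ)).toLinearMap ∘ₗ B),
    fun _ _ => rfl⟩

theorem contDiff_comp_quadratic {f : F → ℝ} (hf : ContDiff ℝ 2 f) (B : E →ₗ[ℝ] E →ₗ[ℝ] F) :
    ContDiff ℝ 2 fun W => f (B W W) := by
  obtain ⟨C, hC⟩ := exists_continuousBilinear B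
  simp only [← hC]
  exact hf.comp (by fun_prop)

theorem fderiv_comp_quadratic {f : F → ℝ} (hf : ContDiff ℝ 2 f) (B : E →ₗ[ℝ] E →ₗ[ℝ] F)
    (W Z : E) :
    fderiv ℝ (fun W => f (B W W)) W Z = fderiv ℝ f (B W W) (B W Z + B Z W) := by
  obtain ⟨C, hC⟩ := exists_continuousBilinear B
  simp only [← hC]
  have h1 : HasFDerivAt (fun W => C W W) _ W :=
    C.hasFDerivAt_of_bilinear (hasFDerivAt_id W) (hasFDerivAt_id W)
  have h2 : HasFDerivAt f _ (C W W) :=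
    (hf.differentiable (by norm_num) (C W W)).hasFDerivAt
  have h3 : HasFDerivAt (fun W => f (C W W)) _ W :=
    HasFDerivAt.comp (f := fun W => C W W) W h2 h1
  rw [h3.fderiv]
  simp

theorem fderiv_fderiv_comp_quadratic {f : F → ℝ} (hf : ContDiff ℝ 2 f)
    (B : E →ₗ[ℝ] E →ₗ[ℝ] F) (W Z : E) :
    fderiv ℝ (fderiv ℝ fun W => f (B W W)) W Z Z =
      fderiv ℝ (fderiv ℝ f) (B W W) (B W Z + B Z W) (B W Z + B Z W) +
        2 * fderiv ℝ f (B W W) (B Z Z) := by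
  -- With the direction `Z` frozen, the explicit first derivative can be differentiated by the
  -- product rule.
  have e1 : fderiv ℝ (fderiv ℝ fun W => f (B W W)) W Z Z =
      fderiv ℝ (fun V => fderiv ℝ (fun W => f (B W W)) V Z) W Z := by
    rw [fderiv_clm_apply
      (differentiable_fderiv_of_contDiff_two (contDiff_comp_quadratic hf B) W) (by fun_prop)]
    simp
  rw [e1]
  simp only [fderiv_comp_quadratic hf B]
  obtain ⟨C, hC⟩ := exists_continuousBilinear B
  simp only [← hC]
  have h1 : HasFDerivAt (fun W => C W W) _ W :=
    C.hasFDerivAt_of_bilinear (hasFDerivAt_id W) (hasFDerivAt_id W)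
  have h2 : HasFDerivAt (fderiv ℝ f) _ (C W W) :=
    (differentiable_fderiv_of_contDiff_two hf (C W W)).hasFDerivAt
  have h3 : HasFDerivAt (fun V => fderiv ℝ f (C V V)) _ W :=
    HasFDerivAt.comp (f := fun W => C W W) W h2 h1
  have h4 : HasFDerivAt (fun V => C V Z + C Z V) (C.flip Z + C Z) W :=
    (C.flip Z + C Z).hasFDerivAt
  rw [(h3.clm_apply h4).fderiv]
  simp
  ring

/-- Mean value theorem for `t ↦ Df(M + tD)[D]` on `[0, 1]`. Curvature is required only on one line
and in its own direction, so restricted convexity suffices. -/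
theorem mul_norm_sq_le_fderiv_sub {f : F → ℝ} (hf : ContDiff ℝ 2 f) {X M : F} {α : ℝ}
    (hM : fderiv ℝ f M = 0)
    (hα : ∀ t : ℝ, α * ‖X - M‖ ^ 2 ≤
      fderiv ℝ (fderiv ℝ f) (M + t • (X - M)) (X - M) (X - M)) :
    α * ‖X - M‖ ^ 2 ≤ fderiv ℝ f X (X - M) := by
  set D := X - M with hD
  have hline : ∀ t : ℝ, HasDerivAt (fun t : ℝ => M + t • D) D t := fun t => by
    simpa using ((hasDerivAt_id t).smul_const D).const_add M
  have hder : ∀ t : ℝ, HasDerivAt (fun t : ℝ => fderiv ℝ f (M + t • D) D)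
      (fderiv ℝ (fderiv ℝ f) (M + t • D) D D) t := fun t => by
    have h1 := (differentiable_fderiv_of_contDiff_two hf (M + t • D)).hasFDerivAt.comp_hasDerivAt t
      (hline t)
    simpa using h1.clm_apply (hasDerivAt_const t D)
  obtain ⟨c, -, hc⟩ := exists_hasDerivAt_eq_slope (fun t : ℝ => fderiv ℝ f (M + t • D) D)
    (fun t => fderiv ℝ (fderiv ℝ f) (M + t • D) D D) (zero_lt_one' ℝ)
    (fun t _ => (hder t).continuousAt.continuousWithinAt) (fun t _ => hder t)
  have := hα c
  rw [hc] at this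
  simpa [hM, hD] using this

end SecondDerivative

/-! ### Euclidean gradient and Hessian as Fréchet derivatives -/

section Calculus

variable {m n : Type*} [Fintype m] [Fintype n] [DecidableEq m] [DecidableEq n]

theorem frobInner_euclGrad (h : Matrix m n ℝ → ℝ) (X Z : Matrix m n ℝ) :
    frobInner (euclGrad h X) Z = fderiv ℝ h X Z := by
  conv_rhs => rw [Matrix.matrix_eq_sum_single Z]
  simp only [map_sum, frobInner, euclGrad, Matrix.of_apply]
  refine Finset.sum_congr rfl fun i _ => Finset.sum_congr rfl fun j _ => ?_
  rw [show Matrix.single i j (Z i j) = Z i j • Matrix.single i j (1 : ℝ) by simp, map_smul,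
    smul_eq_mul, mul_comm]

theorem hessForm_eq_fderiv_fderiv {h : Matrix m n ℝ → ℝ} (hh : ContDiff ℝ 2 h)
    (X Z Z' : Matrix m n ℝ) : hessForm h X Z Z' = fderiv ℝ (fderiv ℝ h) X Z Z' := by
  let J : (m × n → ℝ) →ₗ[ℝ] Matrix m n ℝ :=
    { toFun := fun φ => Matrix.of fun i j => φ (i, j)
      map_add' := fun φ ψ => by ext; simp
      map_smul' := fun c φ => by ext; simp }
  have h1 := fderiv_linear_comp_fderiv hh (fun p : m × n => Matrix.single p.1 p.2 (1 : ℝ)) J X Z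
  have h2 : euclHess h X Z = _ := h1
  conv_rhs => rw [Matrix.matrix_eq_sum_single Z']
  simp only [hessForm, h2, map_sum, frobInner]
  refine Finset.sum_congr rfl fun i _ => Finset.sum_congr rfl fun j _ => ?_
  rw [show Matrix.single i j (Z' i j) = Z' i j • Matrix.single i j (1 : ℝ) by simp, map_smul,
    smul_eq_mul, mul_comm]
  rfl

theorem hessForm_comm {h : Matrix m n ℝ → ℝ} (hh : ContDiff ℝ 2 h) (X Z Z' : Matrix m n ℝ) :
    hessForm h X Z Z' = hessForm h X Z' Z := by
  rw [hessForm_eq_fderiv_fderiv hh, hessForm_eq_fderiv_fderiv hh]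
  exact fderiv_fderiv_comm hh X Z Z'

theorem fderiv_eq_zero_of_euclGrad_eq_zero {h : Matrix m n ℝ → ℝ} {X : Matrix m n ℝ}
    (hX : euclGrad h X = 0) : fderiv ℝ h X = 0 := by
  ext Z
  rw [← frobInner_euclGrad, hX]
  simp [frobInner]

end Calculus

/-! ### Derivatives of the factorized objective -/

section Factorization

variable {p₁ p₂ r : ℕ}

/-- The bilinear map `(W, Z) ↦ W₁ Z₂ᵀ` on stacked matrices. -/
def blockMul :
    Matrix (Fin p₁ ⊕ Fin p₂) (Fin r) ℝ →ₗ[ℝ] Matrix (Fin p₁ ⊕ Fin p₂) (Fin r) ℝ →ₗ[ℝ]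
      Matrix (Fin p₁) (Fin p₂) ℝ :=
  LinearMap.mk₂ ℝ (fun W Z => W.toRows₁ * Z.toRows₂ᵀ)
    (fun A B C => by ext; simp [Matrix.mul_apply, add_mul, Finset.sum_add_distrib])
    (fun c A B => by ext; simp [Matrix.mul_apply, Finset.mul_sum, mul_assoc])
    (fun A B C => by ext; simp [Matrix.mul_apply, mul_add, Finset.sum_add_distrib])
    (fun c A B => by ext; simp [Matrix.mul_apply, Finset.mul_sum, mul_left_comm])

theorem contDiff_factorObj {f : Matrix (Fin p₁) (Fin p₂) ℝ → ℝ} (hf : ContDiff ℝ 2 f) :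
    ContDiff ℝ 2 (factorObj (r := r) f) :=
  contDiff_comp_quadratic hf blockMul

theorem frobInner_euclGrad_factorObj {f : Matrix (Fin p₁) (Fin p₂) ℝ → ℝ} (hf : ContDiff ℝ 2 f)
    (L A : Matrix (Fin p₁) (Fin r) ℝ) (R B : Matrix (Fin p₂) (Fin r) ℝ) :
    frobInner (euclGrad (factorObj f) (fromRows L R)) (fromRows A B) =
      frobInner (euclGrad f (L * Rᵀ)) (L * Bᵀ + A * Rᵀ) := by
  rw [frobInner_euclGrad, frobInner_euclGrad]
  exact fderiv_comp_quadratic hf blockMul (fromRows L R) (fromRows A B)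

theorem hessForm_factorObj {f : Matrix (Fin p₁) (Fin p₂) ℝ → ℝ} (hf : ContDiff ℝ 2 f)
    (L A : Matrix (Fin p₁) (Fin r) ℝ) (R B : Matrix (Fin p₂) (Fin r) ℝ) :
    hessForm (factorObj f) (fromRows L R) (fromRows A B) (fromRows A B) =
      hessForm f (L * Rᵀ) (L * Bᵀ + A * Rᵀ) (L * Bᵀ + A * Rᵀ) +
        2 * frobInner (euclGrad f (L * Rᵀ)) (A * Bᵀ) := by
  rw [hessForm_eq_fderiv_fderiv (contDiff_factorObj hf), hessForm_eq_fderiv_fderiv hf,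
    frobInner_euclGrad]
  exact fderiv_fderiv_comp_quadratic hf blockMul (fromRows L R) (fromRows A B)

end Factorization

/-! ### Rank bounds -/

section Rank

variable {m n : Type*} [Fintype n]

theorem rank_add_le (A B : Matrix m n ℝ) : (A + B).rank ≤ A.rank + B.rank := by
  rw [Matrix.rank, Matrix.rank, Matrix.rank, Matrix.mulVecLin_add]
  exact (Submodule.finrank_mono (LinearMap.range_add_le _ _)).trans
    (Submodule.finrank_add_le_finrank_add_finrank _ _)

theorem rank_smul_le [DecidableEq n] (c : ℝ) (A : Matrix m n ℝ) : (c • A).rank ≤ A.rank := by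
  simpa using Matrix.rank_mul_le_left A (c • (1 : Matrix n n ℝ))

end Rank

/-! ### From a direction of negative curvature to an eigenvalue -/

section Spectral

variable {m n : Type*} [Fintype m] [Fintype n]

/-- In an orthonormal eigenbasis the Rayleigh quotient is a weighted mean of the eigenvalues, so one
of them is at most `c`. -/
theorem exists_hasEigenvalue_le_of_frobInner_le [DecidableEq m] [DecidableEq n]
    {T : Module.End ℝ (Matrix m n ℝ)}
    (hT : ∀ Z Z', frobInner (T Z) Z' = frobInner (T Z') Z) {Z : Matrix m n ℝ} (hZ : Z ≠ 0) {c : ℝ}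
    (hc : frobInner (T Z) Z ≤ c * ‖Z‖ ^ 2) : ∃ t ≤ c, T.HasEigenvalue t := by
  -- Flattening turns `frobInner` into the Euclidean inner product, for which the conjugate of `T`
  -- is symmetric.
  let Φ : Matrix m n ℝ ≃ₗ[ℝ] EuclideanSpace ℝ (m × n) :=
    ((Matrix.ofLinearEquiv ℝ).symm.trans (LinearEquiv.curry ℝ ℝ m n).symm).trans
      (WithLp.linearEquiv 2 ℝ (m × n → ℝ)).symm
  have hΦ : ∀ A B, inner ℝ (Φ A) (Φ B) = frobInner A B := by
    intro A B
    simp [Φ, PiLp.inner_apply, frobInner, Fintype.sum_prod_type, Function.uncurry, mul_comm]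
  let S : Module.End ℝ (EuclideanSpace ℝ (m × n)) := Φ.toLinearMap ∘ₗ T ∘ₗ Φ.symm.toLinearMap
  have hS : S.IsSymmetric := by
    intro x y
    obtain ⟨A, rfl⟩ := Φ.surjective x
    obtain ⟨B, rfl⟩ := Φ.surjective y
    simp [S, hΦ, hT A B, frobInner_comm A]
  set e := hS.eigenvectorBasis rfl with he
  set μ := hS.eigenvalues rfl with hμ
  have hSe : ∀ i, S (e i) = μ i • e i := fun i =>
    hS.apply_eigenvectorBasis rfl i
  have hnorm : ∑ i, inner ℝ (e i) (Φ Z) ^ 2 = ‖Z‖ ^ 2 := by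
    rw [norm_sq_eq_frobInner, ← hΦ, real_inner_self_eq_norm_sq, ← e.sum_sq_norm_inner_right]
    simp
  have hquad : ∑ i, μ i * inner ℝ (e i) (Φ Z) ^ 2 = frobInner (T Z) Z := by
    have h1 : frobInner (T Z) Z = inner ℝ (S (Φ Z)) (Φ Z) := by simp [S, hΦ]
    rw [h1, ← e.sum_inner_mul_inner]
    refine Finset.sum_congr rfl fun i _ => ?_
    rw [hS, hSe, inner_smul_right, real_inner_comm]
    ring
  have hZpos : 0 < ‖Z‖ ^ 2 := by positivity
  obtain ⟨i, hi⟩ : ∃ i, μ i ≤ c := by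
    by_contra! hcon
    have h2 : ∑ i, c * inner ℝ (e i) (Φ Z) ^ 2 < ∑ i, μ i * inner ℝ (e i) (Φ Z) ^ 2 := by
      refine Finset.sum_lt_sum
        (fun i _ => mul_le_mul_of_nonneg_right (hcon i).le (sq_nonneg _)) ?_
      obtain ⟨i, hi, h0⟩ := Finset.exists_ne_zero_of_sum_ne_zero (hnorm.trans_ne hZpos.ne')
      exact ⟨i, hi, mul_lt_mul_of_pos_right (hcon i) (lt_of_le_of_ne (sq_nonneg _) h0.symm)⟩
    rw [hquad, ← Finset.mul_sum, hnorm] at h2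
    linarith
  refine ⟨μ i, hi, Module.End.hasEigenvalue_of_hasEigenvector (x := Φ.symm (e i)) ?_⟩
  rw [Module.End.hasEigenvector_iff, Module.End.mem_eigenspace_iff]
  refine ⟨Φ.injective ?_, ?_⟩
  · have := hSe i
    simpa [S] using this
  · simpa using e.orthonormal.ne_zero i

theorem lambdaMin_le_of_hasEigenvalue {T : Module.End ℝ (Matrix m n ℝ)} {t : ℝ}
    (ht : T.HasEigenvalue t) : lambdaMin T ≤ t :=
  csInf_le T.finite_hasEigenvalue.bddBelow ht

end Spectral

/-! ### Expansions in an eigenbasis of `Aᵀ A` -/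

section Expansion

variable {m n : Type*} [Fintype m] [Fintype n]

theorem dotProduct_mulVec_self (A : Matrix m n ℝ) {ι : Type*} [Fintype ι] (e : ι → n → ℝ)
    (s : ι → ℝ) (he : ∀ w, ∑ i, (e i ⬝ᵥ w) • e i = w)
    (hs : ∀ i, Aᵀ *ᵥ (A *ᵥ e i) = s i • e i) (w : n → ℝ) :
    (A *ᵥ w) ⬝ᵥ (A *ᵥ w) = ∑ i, s i * (e i ⬝ᵥ w) ^ 2 := by
  have h1 : (A *ᵥ w) ⬝ᵥ (A *ᵥ w) = w ⬝ᵥ (Aᵀ *ᵥ (A *ᵥ w)) := by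
    rw [dotProduct_mulVec w, vecMul_transpose]
  have h2 : Aᵀ *ᵥ (A *ᵥ w) = ∑ i, (e i ⬝ᵥ w) • s i • e i := by
    conv_lhs => rw [← he w]
    simp [mulVec_sum, mulVec_smul, hs]
  rw [h1, h2, dotProduct_sum]
  refine Finset.sum_congr rfl fun i _ => ?_
  rw [dotProduct_smul, dotProduct_smul, smul_eq_mul, smul_eq_mul, dotProduct_comm w]
  ring

theorem sum_sq_dotProduct {ι : Type*} [Fintype ι] {e : ι → n → ℝ}
    (he : ∀ w, ∑ i, (e i ⬝ᵥ w) • e i = w) (w : n → ℝ) : ∑ i, (e i ⬝ᵥ w) ^ 2 = w ⬝ᵥ w := by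
  conv_rhs => rw [← he w]
  rw [sum_dotProduct]
  refine Finset.sum_congr rfl fun i _ => ?_
  simp only [smul_dotProduct, smul_eq_mul, he w, pow_two]

end Expansion

theorem rank_eq_finrank_range_toEuclideanLin {m n : Type*} [Fintype m] [Fintype n] [DecidableEq n]
    (A : Matrix m n ℝ) :
    Module.finrank ℝ (Matrix.toEuclideanLin A).range = A.rank := by
  rw [Matrix.rank_eq_finrank_range_toLin A (PiLp.basisFun 2 ℝ m) (PiLp.basisFun 2 ℝ n)]
  rfl

/-! ### Singular values and the singular value decomposition -/

section SingularValues

variable {m n : Type*} [Fintype m] [Fintype n] [DecidableEq m] [DecidableEq n]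

theorem sigma_nonneg (k : ℕ) (A : Matrix m n ℝ) : 0 ≤ sigma k A :=
  LinearMap.singularValues_nonneg _ _

theorem sigma_antitone (A : Matrix m n ℝ) : Antitone fun k => sigma k A := fun _ _ h =>
  LinearMap.singularValues_antitone _ (Nat.sub_le_sub_right h 1)

theorem sigma_succ_pos_iff {k : ℕ} {A : Matrix m n ℝ} : 0 < sigma (k + 1) A ↔ k < A.rank := by
  rw [← rank_eq_finrank_range_toEuclideanLin]
  exact LinearMap.singularValues_pos_iff_lt_finrank_range _

theorem exists_right_singular_basis (A : Matrix m n ℝ) :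
    ∃ e : Fin (Fintype.card n) → n → ℝ,
      (∀ i j, e i ⬝ᵥ e j = if i = j then 1 else 0) ∧
      (∀ w, ∑ i, (e i ⬝ᵥ w) • e i = w) ∧
      ∀ i, Aᵀ *ᵥ (A *ᵥ e i) = sigma (i + 1) A ^ 2 • e i := by
  set T := Matrix.toEuclideanLin A with hT
  have hn : Module.finrank ℝ (EuclideanSpace ℝ n) = Fintype.card n := finrank_euclideanSpace
  set b := T.isSymmetric_adjoint_comp_self.eigenvectorBasis hn with hb
  have hdot : ∀ x y : EuclideanSpace ℝ n, x.ofLp ⬝ᵥ y.ofLp = inner ℝ x y := fun x y => by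
    rw [EuclideanSpace.inner_eq_star_dotProduct, dotProduct_comm]; simp
  refine ⟨fun i => (b i).ofLp, fun i j => ?_, fun w => ?_, fun i => ?_⟩
  · rw [hdot, orthonormal_iff_ite.mp b.orthonormal]
  · have := b.sum_repr' (WithLp.toLp 2 w)
    simpa [← hdot] using congrArg WithLp.ofLp this
  · have h1 : (LinearMap.adjoint T ∘ₗ T) (b i) = sigma (i + 1) A ^ 2 • b i := by
      have := T.isSymmetric_adjoint_comp_self.apply_eigenvectorBasis hn i
      rw [← T.sq_singularValues_fin hn i] at this
      exact this
    rw [hT, ← Matrix.toEuclideanLin_conjTranspose_eq_adjoint] at h1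
    simpa [Matrix.toLpLin_apply] using congrArg WithLp.ofLp h1

theorem dotProduct_mulVec_self_le (A : Matrix m n ℝ) (w : n → ℝ) :
    (A *ᵥ w) ⬝ᵥ (A *ᵥ w) ≤ sigma 1 A ^ 2 * (w ⬝ᵥ w) := by
  obtain ⟨e, -, he, hs⟩ := exists_right_singular_basis A
  rw [dotProduct_mulVec_self A e _ he hs, ← sum_sq_dotProduct he, Finset.mul_sum]
  refine Finset.sum_le_sum fun i _ => mul_le_mul_of_nonneg_right ?_ (sq_nonneg _)
  exact pow_le_pow_left₀ (sigma_nonneg _ _) (sigma_antitone A (by omega)) 2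

theorem le_dotProduct_mulVec_self (A : Matrix m n ℝ) (w : n → ℝ) :
    sigma (Fintype.card n) A ^ 2 * (w ⬝ᵥ w) ≤ (A *ᵥ w) ⬝ᵥ (A *ᵥ w) := by
  obtain ⟨e, -, he, hs⟩ := exists_right_singular_basis A
  rw [dotProduct_mulVec_self A e _ he hs, ← sum_sq_dotProduct he, Finset.mul_sum]
  refine Finset.sum_le_sum fun i _ => mul_le_mul_of_nonneg_right ?_ (sq_nonneg _)
  exact pow_le_pow_left₀ (sigma_nonneg _ _) (sigma_antitone A (by omega)) 2

/-- With `p = Aᵀ w`, Cauchy–Schwarz gives `|p|⁴ = ⟨w, A p⟩² ≤ |w|² |A p|² ≤ σ₁² |w|² |p|²`; cancel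
`|p|²`. No comparison of the singular values of `A` and `Aᵀ` is needed. -/
theorem dotProduct_transpose_mulVec_self_le (A : Matrix m n ℝ) (w : m → ℝ) :
    (Aᵀ *ᵥ w) ⬝ᵥ (Aᵀ *ᵥ w) ≤ sigma 1 A ^ 2 * (w ⬝ᵥ w) := by
  have h1 : (Aᵀ *ᵥ w) ⬝ᵥ (Aᵀ *ᵥ w) = w ⬝ᵥ (A *ᵥ (Aᵀ *ᵥ w)) := by
    rw [dotProduct_mulVec w, ← mulVec_transpose]
  have h2 := dotProduct_mulVec_self_le A (Aᵀ *ᵥ w)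
  set p := Aᵀ *ᵥ w
  have hcs : (w ⬝ᵥ (A *ᵥ p)) ^ 2 ≤ (w ⬝ᵥ w) * ((A *ᵥ p) ⬝ᵥ (A *ᵥ p)) := by
    simpa [dotProduct, pow_two] using
      Finset.sum_mul_sq_le_sq_mul_sq Finset.univ w (A *ᵥ p)
  have hp : 0 ≤ p ⬝ᵥ p := by simpa using dotProduct_star_self_nonneg p
  have hw : 0 ≤ w ⬝ᵥ w := by simpa using dotProduct_star_self_nonneg w
  rw [← h1] at hcs
  rcases hp.eq_or_lt with h0 | h0
  · rw [← h0]; positivity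
  · refine le_of_mul_le_mul_right ?_ h0
    nlinarith [mul_le_mul_of_nonneg_left h2 hw]

theorem exists_singular_value_decomposition {A : Matrix m n ℝ} {r : ℕ} (hr : A.rank = r) :
    ∃ (u : Fin r → m → ℝ) (v : Fin r → n → ℝ),
      (∀ i j, u i ⬝ᵥ u j = if i = j then 1 else 0) ∧
      (∀ i j, v i ⬝ᵥ v j = if i = j then 1 else 0) ∧
      (∀ i, A *ᵥ v i = sigma (i + 1) A • u i) ∧
      (∀ i, Aᵀ *ᵥ u i = sigma (i + 1) A • v i) ∧
      A = ∑ i : Fin r, sigma (i + 1) A • vecMulVec (u i) (v i) := by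
  obtain ⟨e, horth, he, hs⟩ := exists_right_singular_basis A
  have hrn : r ≤ Fintype.card n := hr ▸ A.rank_le_card_width
  have hpos : ∀ i : Fin r, sigma (i + 1) A ≠ 0 := fun i =>
    (sigma_succ_pos_iff.mpr (hr ▸ i.2)).ne'
  have hAA : ∀ x y, (A *ᵥ x) ⬝ᵥ (A *ᵥ y) = x ⬝ᵥ (Aᵀ *ᵥ (A *ᵥ y)) := fun x y => by
    rw [dotProduct_mulVec x, vecMul_transpose]
  have hAv : ∀ i : Fin r, A *ᵥ e (Fin.castLE hrn i) =
      sigma (i + 1) A • (sigma (i + 1) A)⁻¹ • (A *ᵥ e (Fin.castLE hrn i)) := fun i => by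
    rw [smul_smul, mul_inv_cancel₀ (hpos i), one_smul]
  refine ⟨fun i => (sigma (i + 1) A)⁻¹ • (A *ᵥ e (Fin.castLE hrn i)),
    fun i => e (Fin.castLE hrn i), fun i j => ?_, fun i j => ?_, hAv, fun i => ?_, ?_⟩
  · simp only [smul_dotProduct, dotProduct_smul, hAA, hs, horth, smul_eq_mul]
    by_cases hij : i = j
    · subst hij
      have := hpos i
      simp
      field_simp
    · simp [hij, Fin.ext_iff, show (i : ℕ) ≠ j from fun h => hij (Fin.ext h)]
  · simp [horth, Fin.ext_iff]
  · rw [mulVec_smul, hs, smul_smul]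
    congr 1
    have := hpos i
    simp
    field_simp
  · refine Matrix.ext_of_mulVec_single fun k => ?_
    generalize (Pi.single k 1 : n → ℝ) = w
    -- Beyond the rank the singular value is zero, so `|A e_i|² = 0` and the tail of the expansion
    -- drops out.
    have hzero : ∀ i : Fin (Fintype.card n), r ≤ i → A *ᵥ e i = 0 := fun i hi => by
      have h0 : sigma (i + 1) A = 0 :=
        le_antisymm (not_lt.mp fun h => absurd (sigma_succ_pos_iff.mp h) (by omega))
          (sigma_nonneg _ _)
      have h1 := hAA (e i) (e i)
      rw [hs, h0] at h1
      simpa using h1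
    conv_lhs => rw [← he w, mulVec_sum]
    rw [sum_mulVec]
    symm
    refine Finset.sum_of_injOn (Fin.castLE hrn) (Fin.castLE_injective hrn).injOn (by simp) ?_ ?_
    · intro i _ hi
      rw [mulVec_smul, hzero i, smul_zero]
      by_contra! hlt
      exact hi ⟨⟨i, hlt⟩, by simp, rfl⟩
    · intro i _
      rw [smul_mulVec, vecMulVec_mulVec, mulVec_smul]
      simp only [op_smul_eq_smul]
      rw [smul_comm, ← hAv]

end SingularValues

/-! ### Residuals off an orthonormal family -/

section OrthonormalFamilies

variable {ι m : Type*} [Fintype ι] [Fintype m]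

/-- The component of `a` orthogonal to the orthonormal family `u`. -/
def orthResidual (u : ι → m → ℝ) (a : m → ℝ) : m → ℝ :=
  a - ∑ i, (u i ⬝ᵥ a) • u i

variable {u : ι → m → ℝ}

theorem orthResidual_dotProduct_of_forall_eq_zero {z : m → ℝ} (hz : ∀ i, u i ⬝ᵥ z = 0)
    (a : m → ℝ) : orthResidual u a ⬝ᵥ z = a ⬝ᵥ z := by
  simp [orthResidual, sub_dotProduct, sum_dotProduct, smul_dotProduct, hz]

variable [DecidableEq ι]

theorem dotProduct_orthResidual (hu : ∀ i j, u i ⬝ᵥ u j = if i = j then 1 else 0) (a : m → ℝ)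
    (i : ι) : u i ⬝ᵥ orthResidual u a = 0 := by
  simp [orthResidual, dotProduct_sub, dotProduct_sum, dotProduct_smul, hu]

theorem orthResidual_dotProduct_self (hu : ∀ i j, u i ⬝ᵥ u j = if i = j then 1 else 0)
    (a : m → ℝ) :
    orthResidual u a ⬝ᵥ orthResidual u a = a ⬝ᵥ a - ∑ i, (u i ⬝ᵥ a) ^ 2 := by
  have h : orthResidual u a ⬝ᵥ orthResidual u a = a ⬝ᵥ orthResidual u a :=
    orthResidual_dotProduct_of_forall_eq_zero (dotProduct_orthResidual hu a) a
  rw [h, orthResidual, dotProduct_sub, dotProduct_sum]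
  simp [pow_two, dotProduct_comm a]

theorem sum_sq_dotProduct_le (hu : ∀ i j, u i ⬝ᵥ u j = if i = j then 1 else 0)
    (a : m → ℝ) : ∑ i, (u i ⬝ᵥ a) ^ 2 ≤ a ⬝ᵥ a := by
  have h : 0 ≤ orthResidual u a ⬝ᵥ orthResidual u a := by
    simpa using dotProduct_star_self_nonneg (orthResidual u a)
  rw [orthResidual_dotProduct_self hu] at h
  linarith

end OrthonormalFamilies

/-! ### Distance between two matrices of the same rank -/

section LowRankDistance

variable {ι m n : Type*} [Fintype ι] [Fintype m] [Fintype n]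

/-- The right side minus the left is exactly `∑ (σ_i² - s²)(1 - ∑_j w_ij) + ∑ w_ij (σ_i - κ_j)²`.
The `s²` terms balance because rows and columns share one index set. -/
theorem norm_sq_sub_ge_of_substochastic {w : ι → ι → ℝ} {σ κ : ι → ℝ} {s : ℝ} (hs : 0 ≤ s)
    (hσ : ∀ i, s ≤ σ i) (hw : ∀ i j, 0 ≤ w i j) (hrow : ∀ i, ∑ j, w i j ≤ 1) :
    ∑ j, (1 - ∑ i, w i j) * (s ^ 2 + κ j ^ 2) ≤
      ∑ i, σ i ^ 2 + ∑ j, κ j ^ 2 - 2 * ∑ i, ∑ j, σ i * κ j * w i j := by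
  have h1 : 0 ≤ ∑ i, (σ i ^ 2 - s ^ 2) * (1 - ∑ j, w i j) :=
    Finset.sum_nonneg fun i _ => mul_nonneg
      (sub_nonneg.mpr (pow_le_pow_left₀ hs (hσ i) 2)) (sub_nonneg.mpr (hrow i))
  have h2 : 0 ≤ ∑ i, ∑ j, w i j * (σ i - κ j) ^ 2 :=
    Finset.sum_nonneg fun i _ => Finset.sum_nonneg fun j _ => mul_nonneg (hw i j) (sq_nonneg _)
  have e1 : ∑ i, (σ i ^ 2 - s ^ 2) * (1 - ∑ j, w i j) =
      ∑ i, σ i ^ 2 - ∑ _i : ι, s ^ 2 - ∑ i, ∑ j, (σ i ^ 2 * w i j - s ^ 2 * w i j) := by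
    rw [← Finset.sum_sub_distrib, ← Finset.sum_sub_distrib]
    refine Finset.sum_congr rfl fun i _ => ?_
    rw [Finset.sum_sub_distrib, ← Finset.mul_sum, ← Finset.mul_sum]
    ring
  have e2 : ∑ j, (1 - ∑ i, w i j) * (s ^ 2 + κ j ^ 2) =
      ∑ _j : ι, s ^ 2 + ∑ j, κ j ^ 2 - ∑ i, ∑ j, (s ^ 2 * w i j + κ j ^ 2 * w i j) := by
    rw [Finset.sum_comm, ← Finset.sum_add_distrib, ← Finset.sum_sub_distrib]
    refine Finset.sum_congr rfl fun j _ => ?_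
    rw [Finset.sum_add_distrib, ← Finset.mul_sum, ← Finset.mul_sum]
    ring
  have e3 : ∑ i, ∑ j, w i j * (σ i - κ j) ^ 2 =
      ∑ i, ∑ j, (σ i ^ 2 * w i j - s ^ 2 * w i j) + ∑ i, ∑ j, (s ^ 2 * w i j + κ j ^ 2 * w i j) -
        2 * ∑ i, ∑ j, σ i * κ j * w i j := by
    simp only [Finset.mul_sum, ← Finset.sum_add_distrib, ← Finset.sum_sub_distrib]
    exact Finset.sum_congr rfl fun i _ => Finset.sum_congr rfl fun j _ => by ring
  linarith

theorem frobInner_sum_smul_vecMulVec (σ κ : ι → ℝ) (u a : ι → m → ℝ) (v b : ι → n → ℝ) :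
    frobInner (∑ i, σ i • vecMulVec (u i) (v i)) (∑ j, κ j • vecMulVec (a j) (b j)) =
      ∑ i, ∑ j, σ i * κ j * ((u i ⬝ᵥ a j) * (v i ⬝ᵥ b j)) := by
  rw [frobInner_sum_left]
  refine Finset.sum_congr rfl fun i _ => ?_
  rw [frobInner_sum_right]
  refine Finset.sum_congr rfl fun j _ => ?_
  rw [frobInner_smul_left, frobInner_smul_right, frobInner_vecMulVec]
  ring

theorem norm_sq_sum_smul_vecMulVec [DecidableEq ι] (σ : ι → ℝ) {u : ι → m → ℝ} {v : ι → n → ℝ}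
    (hu : ∀ i j, u i ⬝ᵥ u j = if i = j then 1 else 0)
    (hv : ∀ i j, v i ⬝ᵥ v j = if i = j then 1 else 0) :
    ‖∑ i, σ i • vecMulVec (u i) (v i)‖ ^ 2 = ∑ i, σ i ^ 2 := by
  rw [norm_sq_eq_frobInner, frobInner_sum_smul_vecMulVec]
  refine Finset.sum_congr rfl fun i _ => ?_
  rw [Finset.sum_eq_single i (fun j _ hj => by simp [hu, hj.symm]) (by simp)]
  simp [hu, hv, pow_two]

theorem norm_sub_sq_eq (A B : Matrix m n ℝ) :
    ‖A - B‖ ^ 2 = ‖A‖ ^ 2 + ‖B‖ ^ 2 - 2 * frobInner A B := by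
  have h : ∀ C, frobInner (A - B) C = frobInner A C - frobInner B C := fun C => by
    simp only [frobInner_comm _ C, frobInner_sub_right]
  simp only [norm_sq_eq_frobInner, h, frobInner_sub_right, frobInner_comm B A]
  ring

/-- The distance between two matrices in singular value form dominates the part of the second one
that lies outside the singular subspaces of the first. -/
theorem sum_residual_le_norm_sub_sq [DecidableEq ι] {σ κ : ι → ℝ} {u a : ι → m → ℝ} {v b : ι → n → ℝ}
    (hu : ∀ i j, u i ⬝ᵥ u j = if i = j then 1 else 0)
    (hv : ∀ i j, v i ⬝ᵥ v j = if i = j then 1 else 0)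
    (ha : ∀ i j, a i ⬝ᵥ a j = if i = j then 1 else 0)
    (hb : ∀ i j, b i ⬝ᵥ b j = if i = j then 1 else 0)
    {s : ℝ} (hs : 0 ≤ s) (hσ : ∀ i, s ≤ σ i) (hκ : ∀ j, 0 ≤ κ j) :
    ∑ j, (orthResidual u (a j) ⬝ᵥ orthResidual u (a j) +
        orthResidual v (b j) ⬝ᵥ orthResidual v (b j)) / 2 * (s ^ 2 + κ j ^ 2) ≤
      ‖∑ i, σ i • vecMulVec (u i) (v i) - ∑ j, κ j • vecMulVec (a j) (b j)‖ ^ 2 := by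
  -- Averaging the squared overlaps makes the row sums at most 1 by Bessel, makes the column
  -- deficits the averaged residuals, and dominates `(u_i ⬝ᵥ a_j) * (v_i ⬝ᵥ b_j)` by AM–GM.
  set w : ι → ι → ℝ := fun i j => ((u i ⬝ᵥ a j) ^ 2 + (v i ⬝ᵥ b j) ^ 2) / 2 with hw
  have hres : ∀ j, (orthResidual u (a j) ⬝ᵥ orthResidual u (a j) +
      orthResidual v (b j) ⬝ᵥ orthResidual v (b j)) / 2 = 1 - ∑ i, w i j := fun j => by
    rw [orthResidual_dotProduct_self hu, orthResidual_dotProduct_self hv, ha, hb, hw,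
      ← Finset.sum_div, Finset.sum_add_distrib]
    simp
    ring
  have hrow : ∀ i, ∑ j, w i j ≤ 1 := fun i => by
    have h1 := sum_sq_dotProduct_le ha (u i)
    have h2 := sum_sq_dotProduct_le hb (v i)
    rw [hu] at h1
    rw [hv] at h2
    simp only [hw, ← Finset.sum_div, Finset.sum_add_distrib]
    simp only [dotProduct_comm (u i), dotProduct_comm (v i)]
    simp only [if_true] at h1 h2
    linarith
  simp only [hres]
  refine (norm_sq_sub_ge_of_substochastic hs hσ (fun i j => by positivity) hrow).trans ?_
  rw [norm_sub_sq_eq, norm_sq_sum_smul_vecMulVec σ hu hv, norm_sq_sum_smul_vecMulVec κ ha hb,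
    frobInner_sum_smul_vecMulVec]
  have : ∑ i, ∑ j, σ i * κ j * ((u i ⬝ᵥ a j) * (v i ⬝ᵥ b j)) ≤ ∑ i, ∑ j, σ i * κ j * w i j :=
    Finset.sum_le_sum fun i _ => Finset.sum_le_sum fun j _ =>
      mul_le_mul_of_nonneg_left (by simp only [hw]; nlinarith [sq_nonneg (u i ⬝ᵥ a j - v i ⬝ᵥ b j)])
        (mul_nonneg (hs.trans (hσ i)) (hκ j))
  linarith

end LowRankDistance

/-! ### Curvature of the factorized objective at stationary points -/

section StationaryPoints

variable {p₁ p₂ r : ℕ} {f : Matrix (Fin p₁) (Fin p₂) ℝ → ℝ}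
  {L : Matrix (Fin p₁) (Fin r) ℝ} {R : Matrix (Fin p₂) (Fin r) ℝ}

theorem norm_fromRows_sq (A : Matrix (Fin p₁) (Fin r) ℝ) (B : Matrix (Fin p₂) (Fin r) ℝ) :
    ‖fromRows A B‖ ^ 2 = ‖A‖ ^ 2 + ‖B‖ ^ 2 := by
  simp [norm_sq_eq_frobInner, frobInner]

theorem frobInner_euclGrad_eq_zero_of_isFOSP (hf : ContDiff ℝ 2 f)
    (hFOSP : IsFOSP (factorObj f) (fromRows L R)) (A : Matrix (Fin p₁) (Fin r) ℝ)
    (B : Matrix (Fin p₂) (Fin r) ℝ) : frobInner (euclGrad f (L * Rᵀ)) (L * Bᵀ + A * Rᵀ) = 0 := by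
  rw [← frobInner_euclGrad_factorObj hf, show euclGrad (factorObj f) (fromRows L R) = 0 from hFOSP]
  simp [frobInner]

/-- Stationarity tested on `B = y (Rᵀ w)ᵀ`, `A = 0`, since then `L Bᵀ = (L Rᵀ w) yᵀ`. The primed
version perturbs `L` instead. -/
theorem dotProduct_euclGrad_mulVec_eq_zero (hf : ContDiff ℝ 2 f)
    (hFOSP : IsFOSP (factorObj f) (fromRows L R)) (w : Fin p₂ → ℝ) (y : Fin p₂ → ℝ) :
    ((L * Rᵀ) *ᵥ w) ⬝ᵥ (euclGrad f (L * Rᵀ) *ᵥ y) = 0 := by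
  rw [← frobInner_vecMulVec_right]
  have := frobInner_euclGrad_eq_zero_of_isFOSP hf hFOSP 0 (vecMulVec y (Rᵀ *ᵥ w))
  rwa [Matrix.zero_mul, add_zero, transpose_vecMulVec, mul_vecMulVec, mulVec_mulVec] at this

theorem dotProduct_euclGrad_mulVec_eq_zero' (hf : ContDiff ℝ 2 f)
    (hFOSP : IsFOSP (factorObj f) (fromRows L R)) (w : Fin p₁ → ℝ) (x : Fin p₁ → ℝ) :
    x ⬝ᵥ (euclGrad f (L * Rᵀ) *ᵥ ((L * Rᵀ)ᵀ *ᵥ w)) = 0 := by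
  rw [← frobInner_vecMulVec_right]
  have := frobInner_euclGrad_eq_zero_of_isFOSP hf hFOSP (vecMulVec x (Lᵀ *ᵥ w)) 0
  rwa [transpose_zero, Matrix.mul_zero, zero_add, vecMulVec_mul, ← mulVec_transpose, transpose_transpose,
    mulVec_mulVec, ← transpose_transpose R, ← transpose_mul, transpose_transpose] at this

theorem rank_mul_transpose_add_le (A : Matrix (Fin p₁) (Fin r) ℝ) (B : Matrix (Fin p₂) (Fin r) ℝ) :
    (L * Bᵀ + A * Rᵀ).rank ≤ 2 * r := by
  refine (rank_add_le _ _).trans ?_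
  have h1 := (Matrix.rank_mul_le_left L Bᵀ).trans L.rank_le_width
  have h2 := (Matrix.rank_mul_le_left A Rᵀ).trans A.rank_le_width
  omega

/-- The Hessian of the factorized objective along the rank-one direction built from a singular pair
of `L Rᵀ` and an arbitrary pair `(x, y)` with `x` orthogonal to the left singular vector. -/
theorem hessForm_rank_one_direction_le (hf : ContDiff ℝ 2 f) {α₁ α₂ : ℝ} (hr : 0 < r)
    (hRSC : RSCRSM r α₁ α₂ f) (hLR : (L * Rᵀ).rank = r) {s : ℝ}
    {u x : Fin p₁ → ℝ} {v y : Fin p₂ → ℝ} (hu : u ⬝ᵥ u = 1) (hv : v ⬝ᵥ v = 1)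
    (hXv : (L * Rᵀ) *ᵥ v = s • u) (hXu : (L * Rᵀ)ᵀ *ᵥ u = s • v) (hx : u ⬝ᵥ x = 0) :
    hessForm (factorObj f) (fromRows L R)
        (fromRows (vecMulVec x (Lᵀ *ᵥ u)) (vecMulVec y (Rᵀ *ᵥ v)))
        (fromRows (vecMulVec x (Lᵀ *ᵥ u)) (vecMulVec y (Rᵀ *ᵥ v))) ≤
      s * (α₂ * s * (x ⬝ᵥ x + y ⬝ᵥ y) + 2 * (x ⬝ᵥ euclGrad f (L * Rᵀ) *ᵥ y)) := by
  have hLb : L *ᵥ (Rᵀ *ᵥ v) = s • u := by rw [mulVec_mulVec, hXv]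
  have hRa : R *ᵥ (Lᵀ *ᵥ u) = s • v := by
    rw [mulVec_mulVec, ← hXu, transpose_mul, transpose_transpose]
  have hG : L * (vecMulVec y (Rᵀ *ᵥ v))ᵀ + vecMulVec x (Lᵀ *ᵥ u) * Rᵀ =
      s • (vecMulVec u y + vecMulVec x v) := by
    rw [transpose_vecMulVec, mul_vecMulVec, hLb, vecMulVec_mul, ← mulVec_transpose,
      transpose_transpose, hRa, smul_vecMulVec, vecMulVec_smul, smul_add]
  have hab : (Lᵀ *ᵥ u) ⬝ᵥ (Rᵀ *ᵥ v) = s := by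
    rw [mulVec_transpose, ← dotProduct_mulVec, hLb, dotProduct_smul, hu, smul_eq_mul, mul_one]
  have hAB : vecMulVec x (Lᵀ *ᵥ u) * (vecMulVec y (Rᵀ *ᵥ v))ᵀ = s • vecMulVec x y := by
    rw [transpose_vecMulVec, vecMulVec_mul_vecMulVec, hab, vecMulVec_smul]
  -- The cross term vanishes because `u ⬝ᵥ x = 0`; nothing is needed about `v ⬝ᵥ y`.
  have hGnorm : ‖s • (vecMulVec u y + vecMulVec x v)‖ ^ 2 = s ^ 2 * (x ⬝ᵥ x + y ⬝ᵥ y) := by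
    simp only [norm_sq_eq_frobInner, frobInner_smul_left, frobInner_smul_right,
      frobInner_add_left, frobInner_add_right, frobInner_vecMulVec, hu, hv, hx, dotProduct_comm x u]
    ring
  have hrk := rank_mul_transpose_add_le (L := L) (R := R) (vecMulVec x (Lᵀ *ᵥ u))
    (vecMulVec y (Rᵀ *ᵥ v))
  have hup := (hRSC.2.2 (L * Rᵀ) _ (by omega) (hrk.trans (by omega))).2
  rw [hessForm_factorObj hf, hAB, frobInner_smul_right, frobInner_vecMulVec_right]
  rw [hG] at hup ⊢
  rw [hGnorm] at hup
  linarith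

/-- If the Hessian of the factorized objective at a stationary point has no direction of
sufficiently negative curvature, then the stationary point is a factorization of the minimizer. -/
theorem mul_transpose_eq_of_hessForm_ge (hr : 0 < r) (hf : ContDiff ℝ 2 f) {α₁ α₂ : ℝ}
    (hRSC : RSCRSM r α₁ α₂ f) (hα : α₂ ≤ 3 / 2 * α₁) {M : Matrix (Fin p₁) (Fin p₂) ℝ}
    (hM : M.rank = r) (hMgrad : euclGrad f M = 0) (hLR : (L * Rᵀ).rank = r)
    (hFOSP : IsFOSP (factorObj f) (fromRows L R)) {q : ℝ} (hq : 0 ≤ q)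
    (hqL : q * sigma 1 L ^ 2 ≤ sigma r (L * Rᵀ))
    (hqR : q * sigma 1 (L * Rᵀ) ≤ sigma r L ^ 2)
    (hcurv : ∀ Z, -(0.08 * q * α₁ * sigma r M) * ‖Z‖ ^ 2 ≤
      hessForm (factorObj f) (fromRows L R) Z Z) : L * Rᵀ = M := by
  set X := L * Rᵀ with hX
  set F := euclGrad f X with hF
  have hα₁ : 0 < α₁ := hRSC.1
  obtain ⟨k, rfl⟩ : ∃ k, r = k + 1 := ⟨r - 1, by omega⟩
  set s := sigma (k + 1) X with hs_def
  set κ := sigma (k + 1) M with hκ_def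
  have hs : 0 < s := sigma_succ_pos_iff.mpr (by omega)
  have hκ : 0 < κ := sigma_succ_pos_iff.mpr (by omega)
  obtain ⟨u, v, hu, hv, hXv, hXu, hXsvd⟩ := exists_singular_value_decomposition hLR
  obtain ⟨a, b, ha, hb, -, -, hMsvd⟩ := exists_singular_value_decomposition hM
  have hpos : ∀ i : Fin (k + 1), 0 < sigma (i + 1) X := fun i =>
    sigma_succ_pos_iff.mpr (by have := i.2; omega)
  have hFu : ∀ i y, u i ⬝ᵥ F *ᵥ y = 0 := fun i y => by
    have := dotProduct_euclGrad_mulVec_eq_zero hf hFOSP (v i) y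
    rw [← hX, hXv, smul_dotProduct, smul_eq_mul] at this
    exact (mul_eq_zero.mp this).resolve_left (hpos i).ne'
  have hFv : ∀ i x, x ⬝ᵥ F *ᵥ v i = 0 := fun i x => by
    have := dotProduct_euclGrad_mulVec_eq_zero' hf hFOSP (u i) x
    rw [← hX, hXu, mulVec_smul, dotProduct_smul, smul_eq_mul] at this
    exact (mul_eq_zero.mp this).resolve_left (hpos i).ne'
  set x := fun j => orthResidual u (a j) with hx_def
  set y := fun j => orthResidual v (b j) with hy_def
  have hFxy : ∀ j, x j ⬝ᵥ F *ᵥ y j = a j ⬝ᵥ F *ᵥ b j := fun j => by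
    rw [hx_def, orthResidual_dotProduct_of_forall_eq_zero (fun i => hFu i _), dotProduct_mulVec,
      dotProduct_comm, hy_def, orthResidual_dotProduct_of_forall_eq_zero, dotProduct_comm,
      ← dotProduct_mulVec]
    intro i
    rw [dotProduct_comm, ← dotProduct_mulVec, hFv]
  set γ := fun j => (x j ⬝ᵥ x j + y j ⬝ᵥ y j) / 2 with hγ_def
  have hnn : ∀ {N : ℕ} (z : Fin N → ℝ), 0 ≤ z ⬝ᵥ z := fun z => by
    simpa using dotProduct_star_self_nonneg z
  have hγ : ∀ j, 0 ≤ γ j := fun j => div_nonneg (add_nonneg (hnn _) (hnn _)) two_pos.le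
  -- The last index carries the smallest nonzero singular value, `sigma (k + 1) X = s`.
  set i₀ : Fin (k + 1) := Fin.last k with hi₀
  have hXv₀ : X *ᵥ v i₀ = s • u i₀ := hXv i₀
  have hXu₀ : Xᵀ *ᵥ u i₀ = s • v i₀ := hXu i₀
  have hu₀ : u i₀ ⬝ᵥ u i₀ = 1 := by simp [hu]
  have hv₀ : v i₀ ⬝ᵥ v i₀ = 1 := by simp [hv]
  have hqa : q * ((Lᵀ *ᵥ u i₀) ⬝ᵥ (Lᵀ *ᵥ u i₀)) ≤ s := by
    have := dotProduct_transpose_mulVec_self_le L (u i₀)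
    rw [hu₀, mul_one] at this
    exact (mul_le_mul_of_nonneg_left this hq).trans hqL
  -- Here `L (Rᵀ v) = s u` gives `σ_r(L)² |Rᵀ v|² ≤ s²`, and `q s ≤ q σ₁(X) ≤ σ_r(L)²`. With `hqa`,
  -- this explains the two entries of the minimum: `q` times the squared norm of the test direction
  -- is at most `s (|x|² + |y|²)`.
  have hqb : q * ((Rᵀ *ᵥ v i₀) ⬝ᵥ (Rᵀ *ᵥ v i₀)) ≤ s := by
    have h1 := le_dotProduct_mulVec_self L (Rᵀ *ᵥ v i₀)
    rw [mulVec_mulVec, ← hX, hXv₀, smul_dotProduct, dotProduct_smul, hu₀, Fintype.card_fin] at h1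
    simp only [smul_eq_mul, mul_one] at h1
    have h2 : s ≤ sigma 1 X := sigma_antitone X (by omega)
    have h3 : q * s ≤ sigma (k + 1) L ^ 2 := (mul_le_mul_of_nonneg_left h2 hq).trans hqR
    have h4 := mul_le_mul_of_nonneg_right h3 (hnn (Rᵀ *ᵥ v i₀))
    refine le_of_mul_le_mul_left ?_ hs
    linarith
  set C := α₂ * s + 0.08 * α₁ * κ with hC
  have hj : ∀ j, -(a j ⬝ᵥ F *ᵥ b j) ≤ C * γ j := fun j => by
    have h1 := hessForm_rank_one_direction_le hf hr hRSC hLR (y := y j) hu₀ hv₀ hXv₀ hXu₀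
      (dotProduct_orthResidual hu (a j) i₀)
    have h2 := (hcurv _).trans h1
    rw [norm_fromRows_sq, norm_sq_eq_frobInner, norm_sq_eq_frobInner, frobInner_vecMulVec,
      frobInner_vecMulVec] at h2
    change _ ≤ s * (α₂ * s * (x j ⬝ᵥ x j + y j ⬝ᵥ y j) + 2 * (x j ⬝ᵥ F *ᵥ y j)) at h2
    rw [hFxy] at h2
    have h3 := mul_le_mul_of_nonneg_left hqa (hnn (x j))
    have h4 := mul_le_mul_of_nonneg_left hqb (hnn (y j))
    have h5 : 0 ≤ 0.08 * α₁ * κ := by positivity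
    have h6 := mul_le_mul_of_nonneg_left (add_le_add h3 h4) h5
    refine le_of_mul_le_mul_left ?_ hs
    simp only [hC, hγ_def]
    simp only [hx_def] at h6 h2 ⊢
    linarith
  have hgradX : frobInner F X = 0 := by
    have := frobInner_euclGrad_eq_zero_of_isFOSP hf hFOSP 0 R
    simpa using this
  have hFM : frobInner F M = ∑ j : Fin (k + 1), sigma (j + 1) M * (a j ⬝ᵥ F *ᵥ b j) := by
    conv_lhs => rw [hMsvd]
    simp only [frobInner_sum_right, frobInner_smul_right, frobInner_vecMulVec_right]
  have hκj : ∀ j : Fin (k + 1), κ ≤ sigma (j + 1) M := fun j =>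
    sigma_antitone M (by omega)
  have hupper : -frobInner F M ≤ C * ∑ j : Fin (k + 1), γ j * sigma (j + 1) M := by
    rw [hFM, ← Finset.sum_neg_distrib, Finset.mul_sum]
    refine Finset.sum_le_sum fun j _ => ?_
    have := mul_le_mul_of_nonneg_left (hj j) (sigma_nonneg (j + 1) M)
    linarith
  have hstrong : α₁ * ‖X - M‖ ^ 2 ≤ -frobInner F M := by
    have h1 : α₁ * ‖X - M‖ ^ 2 ≤ fderiv ℝ f X (X - M) := by
      refine mul_norm_sq_le_fderiv_sub hf (fderiv_eq_zero_of_euclGrad_eq_zero hMgrad) fun t => ?_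
      have hcomb : M + t • (X - M) = (1 - t) • M + t • X := by module
      have hsub : X - M = (1 : ℝ) • X + (-1 : ℝ) • M := by module
      have hr1 : (M + t • (X - M)).rank ≤ 2 * (k + 1) := by
        rw [hcomb]
        have h1 := rank_add_le ((1 - t) • M) (t • X)
        have h2 := rank_smul_le (1 - t) M
        have h3 := rank_smul_le t X
        omega
      have hr2 : (X - M).rank ≤ 4 * (k + 1) := by
        rw [hsub]
        have h1 := rank_add_le ((1 : ℝ) • X) ((-1 : ℝ) • M)
        have h2 := rank_smul_le (1 : ℝ) X
        have h3 := rank_smul_le (-1 : ℝ) M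
        omega
      have h := (hRSC.2.2 _ _ hr1 hr2).1
      rw [hessForm_eq_fderiv_fderiv hf] at h
      exact h
    rw [← frobInner_euclGrad, frobInner_sub_right] at h1
    linarith
  have hdist : ∑ j : Fin (k + 1), γ j * (s ^ 2 + sigma (j + 1) M ^ 2) ≤ ‖X - M‖ ^ 2 := by
    have := sum_residual_le_norm_sub_sq (σ := fun i : Fin (k + 1) => sigma (i + 1) X)
      (κ := fun i : Fin (k + 1) => sigma (i + 1) M) hu hv ha hb hs.le
      (fun i => sigma_antitone X (by omega)) (fun j => sigma_nonneg _ _)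
    rwa [← hXsvd, ← hMsvd] at this
  set S := ∑ j : Fin (k + 1), γ j * sigma (j + 1) M with hS
  -- Expanding `(s - 3/4 z)² ≥ 0` leaves `1 - 9/16 = 7/16` of `z²`. The coefficient `3/2` of `s z`
  -- is chosen to absorb `α₂ / α₁`.
  have hscalar : ∀ z : ℝ, κ ≤ z → (3 / 2 * s + 7 / 16 * κ) * z ≤ s ^ 2 + z ^ 2 := fun z hz => by
    have := mul_le_mul_of_nonneg_right hz (hκ.le.trans hz)
    linarith [sq_nonneg (s - 3 / 4 * z)]
  have hlower : (3 / 2 * s + 7 / 16 * κ) * S ≤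
      ∑ j : Fin (k + 1), γ j * (s ^ 2 + sigma (j + 1) M ^ 2) := by
    rw [hS, Finset.mul_sum]
    refine Finset.sum_le_sum fun j _ => ?_
    have h1 := hscalar _ (hκj j)
    have := mul_le_mul_of_nonneg_left h1 (hγ j)
    linarith
  have hS0 : 0 ≤ S := Finset.sum_nonneg fun j _ => mul_nonneg (hγ j) (sigma_nonneg _ _)
  have hchain : α₁ * ((3 / 2 * s + 7 / 16 * κ) * S) ≤ C * S :=
    ((mul_le_mul_of_nonneg_left (hlower.trans hdist) hα₁.le).trans hstrong).trans hupper
  have hSle : S ≤ 0 := by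
    have h1 : α₂ * s ≤ 3 / 2 * α₁ * s := mul_le_mul_of_nonneg_right hα hs.le
    have h2 : 0 < α₁ * κ := mul_pos hα₁ hκ
    -- The `s` terms are controlled by `α₂ ≤ 3/2 α₁`; strictness comes from `7/16 > 0.08`.
    have h3 : 0 < α₁ * (3 / 2 * s + 7 / 16 * κ) - C := by
      rw [hC]; linarith
    refine nonpos_of_mul_nonpos_right ?_ h3
    linarith
  have hSeq : S = 0 := le_antisymm hSle hS0
  have hD : ‖X - M‖ ^ 2 ≤ 0 := by
    have h1 := hstrong.trans hupper
    rw [hSeq, mul_zero] at h1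
    exact nonpos_of_mul_nonpos_right h1 hα₁
  have : ‖X - M‖ = 0 := pow_eq_zero_iff two_ne_zero |>.mp (le_antisymm hD (sq_nonneg _))
  exact sub_eq_zero.mp (norm_eq_zero.mp this)

/-- When the gradient of `f` vanishes, the indefinite term of the Hessian disappears and restricted
convexity controls the rest. -/
theorem isSOSP_factorObj_of_euclGrad_eq_zero (hf : ContDiff ℝ 2 f) {α₁ α₂ : ℝ}
    (hRSC : RSCRSM r α₁ α₂ f) (hLR : (L * Rᵀ).rank = r) (hgrad : euclGrad f (L * Rᵀ) = 0)
    (hFOSP : IsFOSP (factorObj f) (fromRows L R)) : IsSOSP (factorObj f) (fromRows L R) := by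
  refine ⟨hFOSP, fun Z => ?_⟩
  have hrk := rank_mul_transpose_add_le (L := L) (R := R) Z.toRows₁ Z.toRows₂
  have h := (hRSC.2.2 (L * Rᵀ) _ (by omega) (hrk.trans (by omega))).1
  rw [← fromRows_toRows Z, hessForm_factorObj hf, hgrad]
  have h0 : 0 ≤ α₁ * ‖L * Z.toRows₂ᵀ + Z.toRows₁ * Rᵀ‖ ^ 2 :=
    mul_nonneg hRSC.1.le (sq_nonneg _)
  have h1 : frobInner 0 (Z.toRows₁ * Z.toRows₂ᵀ) = 0 := by simp [frobInner]
  rw [h1]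
  linarith

end StationaryPoints
end LowRankFactorization

/-! ### The dichotomy -/

theorem mainTheorem9 {p₁ p₂ r : ℕ} (hr : 0 < r)
    (f : Matrix (Fin p₁) (Fin p₂) ℝ → ℝ) (hf : ContDiff ℝ 2 f)
    (α₁ α₂ : ℝ) (hRSC : LowRankFactorization.RSCRSM r α₁ α₂ f) (hα : α₂ / α₁ ≤ 1.5)
    (Xstar : Matrix (Fin p₁) (Fin p₂) ℝ) (hXrank : Xstar.rank = r)
    (hXgrad : LowRankFactorization.euclGrad f Xstar = 0)
    (L : Matrix (Fin p₁) (Fin r) ℝ) (R : Matrix (Fin p₂) (Fin r) ℝ)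
    (hLR : (L * Rᵀ).rank = r)
    (hFOSP : LowRankFactorization.IsFOSP (LowRankFactorization.factorObj f)
      (Matrix.fromRows L R)) :
    (LowRankFactorization.IsSOSP (LowRankFactorization.factorObj f) (Matrix.fromRows L R) ∧
        L * Rᵀ = Xstar) ∨
      (LowRankFactorization.IsStrictSaddle (LowRankFactorization.factorObj f)
          (Matrix.fromRows L R) ∧
        LowRankFactorization.lambdaMin
            (LowRankFactorization.euclHess (LowRankFactorization.factorObj f)
              (Matrix.fromRows L R)) ≤
          -0.08 *
            min (LowRankFactorization.sigma r L ^ 2 / LowRankFactorization.sigma 1 (L * Rᵀ))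
              (LowRankFactorization.sigma r (L * Rᵀ) / LowRankFactorization.sigma 1 L ^ 2) *
            α₁ * LowRankFactorization.sigma r Xstar) := by
  open LowRankFactorization in
  by_cases hEq : L * Rᵀ = Xstar
  · exact .inl ⟨isSOSP_factorObj_of_euclGrad_eq_zero hf hRSC hLR (hEq ▸ hXgrad) hFOSP, hEq⟩
  right
  have hα₁ : 0 < α₁ := hRSC.1
  have hα' : α₂ ≤ 3 / 2 * α₁ := by
    rw [div_le_iff₀ hα₁] at hα
    linarith
  have hLrank : L.rank = r :=
    le_antisymm L.rank_le_width (hLR.ge.trans (Matrix.rank_mul_le_left L Rᵀ))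
  have hpos : ∀ {a b : ℕ} {A : Matrix (Fin a) (Fin b) ℝ}, A.rank = r →
      0 < sigma r A ∧ 0 < sigma 1 A := fun {a b A} hA => by
    refine ⟨?_, sigma_succ_pos_iff.mpr (by omega)⟩
    obtain ⟨k, rfl⟩ : ∃ k, r = k + 1 := ⟨r - 1, by omega⟩
    exact sigma_succ_pos_iff.mpr (by omega)
  obtain ⟨hLr, hL1⟩ := hpos hLrank
  obtain ⟨hXr, hX1⟩ := hpos hLR
  obtain ⟨hMr, -⟩ := hpos hXrank
  set q := min (sigma r L ^ 2 / sigma 1 (L * Rᵀ)) (sigma r (L * Rᵀ) / sigma 1 L ^ 2) with hq_def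
  have hq : 0 < q := lt_min (by positivity) (by positivity)
  have hqR : q * sigma 1 (L * Rᵀ) ≤ sigma r L ^ 2 :=
    (le_div_iff₀ hX1).mp (min_le_left _ _)
  have hqL : q * sigma 1 L ^ 2 ≤ sigma r (L * Rᵀ) :=
    (le_div_iff₀ (by positivity)).mp (min_le_right _ _)
  -- Since `L * Rᵀ ≠ Xstar`, the contrapositive supplies a direction of strongly negative curvature,
  -- and the Rayleigh argument turns it into an eigenvalue.
  obtain ⟨Z, hZ⟩ : ∃ Z, hessForm (factorObj f) (fromRows L R) Z Z <
      -(0.08 * q * α₁ * sigma r Xstar) * ‖Z‖ ^ 2 := by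
    by_contra! hcon
    exact hEq (mul_transpose_eq_of_hessForm_ge hr hf hRSC hα' hXrank hXgrad hLR hFOSP hq.le hqL hqR
      hcon)
  have hZ0 : Z ≠ 0 := by
    rintro rfl
    simp [hessForm, frobInner] at hZ
  obtain ⟨t, ht, hev⟩ := exists_hasEigenvalue_le_of_frobInner_le
    (T := euclHess (factorObj f) (fromRows L R))
    (fun Z Z' => hessForm_comm (contDiff_factorObj hf) (fromRows L R) Z Z') hZ0 hZ.le
  have hneg : 0 < 0.08 * q * α₁ * sigma r Xstar := by positivity
  refine ⟨⟨hFOSP, t, by linarith, hev⟩, (lambdaMin_le_of_hasEigenvalue hev).trans (ht.trans ?_)⟩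
  linarith
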